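/- Let $\mathcal L$ be a finite bounded distributive lattice with $0\neq 1$, regarded as a Heyting algebra, and for $\ell,x\in\mathcal L$ put $T_\ell(x)=1$ if $x=\ell$ and $T_\ell(x)=0$ otherwise. An $\mathcal L$-$\mathcal{VL}$-algebra is a structure $(\mathcal A,\wedge,\vee,\rightarrow,T_\ell\,(\ell\in\mathcal L),0,1)$ such that $(\mathcal A,\wedge,\vee,\rightarrow,0,1)$ is a Heyting algebra and, for all $a,b\in\mathcal A$ and $\ell,\ell_1,\ell_2\in\mathcal L$: (1) $T_{\ell_1}(a)\wedge T_{\ell_2}(b)\le T_{\ell_1\rightarrow \ell_2}(a\rightarrow b)\wedge T_{\ell_1\wedge \ell_2}(a\wedge b)\wedge T_{\ell_1\vee \ell_2}(a\vee b)$ and $T_{\ell_2}(a)\le T_{T_{\ell_1}(\ell_2)}(T_{\ell_1}(a))$; (2) $T_0(0)=1$, $T_\ell(0)=0$ if $\ell\ne0$, $T_1(1)=1$, $T_\ell(1)=0$ if $\ell\neq1$; (3) $\bigvee_{\ell\in\mathcal L}T_\ell(a)=1$, $T_\ell(a)\vee(T_\ell(a)\rightarrow0)=1$, and $T_{\ell_1}(a)\wedge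 T_{\ell_2}(a)=0$ if $\ell_1\ne \ell_2$; (4) $T_1(T_\ell(a))=T_\ell(a)$, $T_0(T_\ell(a))=T_\ell(a)\rightarrow0$, and $T_{\ell_2}(T_{\ell_1}(a))=0$ if $\ell_2\ne0,1$; (5) $T_1(a)\le a$ and $T_1(a\wedge b)=T_1(a)\wedge T_1(b)$; (6) $\bigwedge_{\ell\in\mathcal L}(T_\ell(a)\leftrightarrow T_\ell(b))\le (a\leftrightarrow b)$. Let $\mathcal{VA}_{\mathcal L}$ be the category of $\mathcal L$-$\mathcal{VL}$-algebras and maps preserving all the operations. The lattice $\mathcal L$ is itself an object of it. A bitopological space $(B,\tau_1,\tau_2)$ is a pairwise Boolean space if (a) the $\tau_1$-open $\tau_2$-closed sets form a basis of $\tau_1$ and the $\tau_2$-open $\tau_1$-closed sets form a basis of $\tau_2$; (b) for all $x,y\in B$ with $x\ne y$ there are disjoint $U\in\tau_1$, $V\in\tau_2$ with $x\in U$, $y\in V$; (c) every cover of $B$ by members of $\tau_1\cup\tau_2$ has a finite subcover. An object of the category $PBS_{\mathcal L}$ is a pairwise Boolean space $B$ with a map $\alpha_B$ that assigns to every subalgebra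 $\mathcal M$ of $\mathcal L$ (a subset closed under $\wedge,\vee,\rightarrow$, all $T_\ell$, $0$ and $1$) a subset $\alpha_B(\mathcal M)$ of $B$ that is both $\tau_1$-closed and $\tau_2$-closed, with $\alpha_B(\mathcal L)=B$ and $\alpha_B(\mathcal M\cap\mathcal N)=\alpha_B(\mathcal M)\cap\alpha_B(\mathcal N)$. A morphism $f:(B,\alpha_B)\to(B',\alpha_{B'})$ is a map that is continuous for both the first and the second topologies and satisfies $f(\alpha_B(\mathcal M))\subseteq\alpha_{B'}(\mathcal M)$ for every subalgebra $\mathcal M$. The lattice $\mathcal L$, with the discrete topology taken twice and $\alpha_{\mathcal L}(\mathcal M)=\mathcal M$, is an object of $PBS_{\mathcal L}$. Let $F:PBS_{\mathcal L}^{op}\to\mathcal{VA}_{\mathcal L}$ send $(B,\alpha_B)$ to $\mathrm{Hom}_{PBS_{\mathcal L}}((B,\alpha_B),(\mathcal L,\alpha_{\mathcal L}))$ with the pointwise operations and act on morphisms by composition. Let $G:\mathcal{VA}_{\mathcal L}\to PBS_{\mathcal L}^{op}$ send $\mathcal A$ to $\mathrm{Hom}_{\mathcal{VA}_{\mathcal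 L}}(\mathcal A,\mathcal L)$, whose first topology has as a basis the sets $\langle a\rangle=\{v: v(a)=1\}$, $a\in\mathcal A$, and whose second topology has as a basis their complements, together with $\alpha_{\mathcal A}(\mathcal M)=\{v: v(\mathcal A)\subseteq\mathcal M\}$, and act on morphisms by composition. Then the categories $\mathcal{VA}_{\mathcal L}$ and $PBS_{\mathcal L}$ are dually equivalent: there is an equivalence of categories between $\mathcal{VA}_{\mathcal L}$ and $PBS_{\mathcal L}^{op}$ given by the functors $G$ and $F$. -/

import Mathlib

open CategoryTheory TopologicalSpace
open scoped Topology

universe u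

/-! ### Algebras of lattice-valued logic

A finite bounded distributive lattice carries exactly one Heyting implication, so the truth value
lattice `L` is given as a finite Heyting algebra. -/

open Classical in
/-- The operation `T_l` on the lattice of truth values itself: `T_l(x) = 1` if `x = l`, and
`T_l(x) = 0` otherwise. -/
noncomputable def truthT {L : Type u} [HeytingAlgebra L] (l x : L) : L :=
  if x = l then ⊤ else ⊥

/-- `L`-`VL`-algebras: Heyting algebras `A` with unary operations `T_l`, `l ∈ L`. -/
class VLAlgebra (L : Type u) [HeytingAlgebra L] [Fintype L] (A : Type u) [HeytingAlgebra A] where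
  /-- the operations `T_l` -/
  T : L → A → A
  T_himp_inf_sup : ∀ (l₁ l₂ : L) (a b : A),
    T l₁ a ⊓ T l₂ b ≤ T (l₁ ⇨ l₂) (a ⇨ b) ⊓ T (l₁ ⊓ l₂) (a ⊓ b) ⊓ T (l₁ ⊔ l₂) (a ⊔ b)
  T_le_T_truthT : ∀ (l₁ l₂ : L) (a : A), T l₂ a ≤ T (truthT l₁ l₂) (T l₁ a)
  T_bot_bot : T ⊥ ⊥ = ⊤
  T_of_ne_bot : ∀ l : L, l ≠ ⊥ → T l ⊥ = ⊥
  T_top_top : T ⊤ ⊤ = ⊤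
  T_of_ne_top : ∀ l : L, l ≠ ⊤ → T l ⊤ = ⊥
  sup_T : ∀ a : A, (Finset.univ.sup fun l : L => T l a) = ⊤
  T_sup_himp_bot : ∀ (l : L) (a : A), T l a ⊔ (T l a ⇨ ⊥) = ⊤
  T_inf_T : ∀ (l₁ l₂ : L) (a : A), l₁ ≠ l₂ → T l₁ a ⊓ T l₂ a = ⊥
  T_top_T : ∀ (l : L) (a : A), T ⊤ (T l a) = T l a
  T_bot_T : ∀ (l : L) (a : A), T ⊥ (T l a) = (T l a ⇨ ⊥)
  T_T : ∀ (l₁ l₂ : L) (a : A), l₂ ≠ ⊥ → l₂ ≠ ⊤ → T l₂ (T l₁ a) = ⊥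
  T_top_le : ∀ a : A, T ⊤ a ≤ a
  T_top_inf : ∀ a b : A, T ⊤ (a ⊓ b) = T ⊤ a ⊓ T ⊤ b
  inf_T_iff_le : ∀ a b : A,
    (Finset.univ.inf fun l : L => (T l a ⇨ T l b) ⊓ (T l b ⇨ T l a)) ≤ (a ⇨ b) ⊓ (b ⇨ a)

/-- Homomorphisms of `L`-`VL`-algebras: maps preserving all the operations. -/
@[ext]
structure VLHom (L : Type u) [HeytingAlgebra L] [Fintype L] (A B : Type u)
    [HeytingAlgebra A] [VLAlgebra L A] [HeytingAlgebra B] [VLAlgebra L B] where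
  /-- the underlying map -/
  toFun : A → B
  map_inf : ∀ a b, toFun (a ⊓ b) = toFun a ⊓ toFun b
  map_sup : ∀ a b, toFun (a ⊔ b) = toFun a ⊔ toFun b
  map_himp : ∀ a b, toFun (a ⇨ b) = (toFun a ⇨ toFun b)
  map_T : ∀ (l : L) (a : A), toFun (VLAlgebra.T l a) = VLAlgebra.T l (toFun a)
  map_bot : toFun ⊥ = ⊥
  map_top : toFun ⊤ = ⊤

/-- The objects of the category of `L`-`VL`-algebras. -/
structure VLAlg (L : Type u) [HeytingAlgebra L] [Fintype L] where
  /-- the underlying type -/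
  carrier : Type u
  [heyting : HeytingAlgebra carrier]
  [vl : VLAlgebra L carrier]

attribute [instance] VLAlg.heyting VLAlg.vl

/-- The category of `L`-`VL`-algebras and homomorphisms. -/
instance VLAlg.category (L : Type u) [HeytingAlgebra L] [Fintype L] : Category (VLAlg L) where
  Hom A B := VLHom L A.carrier B.carrier
  id A :=
    { toFun := fun a => a
      map_inf := fun _ _ => rfl
      map_sup := fun _ _ => rfl
      map_himp := fun _ _ => rfl
      map_T := fun _ _ => rfl
      map_bot := rfl
      map_top := rfl }
  comp f g :=
    { toFun := fun a => g.toFun (f.toFun a)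
      map_inf := fun a b => by rw [f.map_inf, g.map_inf]
      map_sup := fun a b => by rw [f.map_sup, g.map_sup]
      map_himp := fun a b => by rw [f.map_himp, g.map_himp]
      map_T := fun l a => by rw [f.map_T, g.map_T]
      map_bot := by rw [f.map_bot, g.map_bot]
      map_top := by rw [f.map_top, g.map_top] }

/-- The lattice of truth values is itself an `L`-`VL`-algebra. -/
noncomputable instance truthVLAlgebra (L : Type u) [HeytingAlgebra L] [Fintype L] :
    VLAlgebra L L where
  T := truthT
  T_himp_inf_sup l₁ l₂ a b := by
    unfold truthT
    by_cases h₁ : a = l₁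
    · by_cases h₂ : b = l₂
      · simp [h₁, h₂]
      · simp [h₂]
    · simp [h₁]
  T_le_T_truthT l₁ l₂ a := by
    unfold truthT
    by_cases h : a = l₂
    · subst h
      simp
    · simp [h]
  T_bot_bot := by simp [truthT]
  T_of_ne_bot l h := by simp [truthT, h.symm]
  T_top_top := by simp [truthT]
  T_of_ne_top l h := by simp [truthT, h.symm]
  sup_T a := by
    refine top_le_iff.1 (le_trans ?_ (Finset.le_sup (Finset.mem_univ a)))
    simp [truthT]
  T_sup_himp_bot l a := by
    unfold truthT
    by_cases h : a = l
    · simp [h]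
    · simp [h]
  T_inf_T l₁ l₂ a h := by
    unfold truthT
    by_cases h₁ : a = l₁
    · have h₂ : a ≠ l₂ := fun h' => h (h₁.symm.trans h')
      simp [h₂]
    · simp [h₁]
  T_top_T l a := by
    unfold truthT
    by_cases h : a = l
    · simp [h]
    · by_cases h' : (⊥ : L) = ⊤
      · simp [h, h']
      · simp [h, h']
  T_bot_T l a := by
    unfold truthT
    by_cases h : a = l
    · by_cases h' : (⊤ : L) = ⊥
      · simp [h, h']
      · simp [h, h']
    · simp [h]
  T_T l₁ l₂ a h h' := by
    unfold truthT
    by_cases h₁ : a = l₁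
    · simp [h₁, h'.symm]
    · simp [h₁, h.symm]
  T_top_le a := by
    unfold truthT
    by_cases h : a = ⊤
    · simp [h]
    · simp [h]
  T_top_inf a b := by
    unfold truthT
    by_cases h : a = ⊤
    · by_cases h' : b = ⊤
      · simp [h, h']
      · simp [h, h']
    · simp [h]
  inf_T_iff_le a b := by
    refine le_trans (Finset.inf_le (Finset.mem_univ a)) ?_
    unfold truthT
    by_cases h : b = a
    · simp [h]
    · simp [h]

/-- Subalgebras of the lattice of truth values. -/
@[ext]
structure TruthSubalgebra (L : Type u) [HeytingAlgebra L] [Fintype L] where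
  /-- the underlying set -/
  carrier : Set L
  inf_mem : ∀ {x y}, x ∈ carrier → y ∈ carrier → x ⊓ y ∈ carrier
  sup_mem : ∀ {x y}, x ∈ carrier → y ∈ carrier → x ⊔ y ∈ carrier
  himp_mem : ∀ {x y}, x ∈ carrier → y ∈ carrier → (x ⇨ y) ∈ carrier
  T_mem : ∀ (l : L) {x}, x ∈ carrier → VLAlgebra.T l x ∈ carrier
  bot_mem : ⊥ ∈ carrier
  top_mem : ⊤ ∈ carrier

/-- `L` as a subalgebra of itself. -/
instance TruthSubalgebra.instTop (L : Type u) [HeytingAlgebra L] [Fintype L] :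
    Top (TruthSubalgebra L) where
  top :=
    { carrier := Set.univ
      inf_mem := fun _ _ => Set.mem_univ _
      sup_mem := fun _ _ => Set.mem_univ _
      himp_mem := fun _ _ => Set.mem_univ _
      T_mem := fun _ _ _ => Set.mem_univ _
      bot_mem := Set.mem_univ _
      top_mem := Set.mem_univ _ }

/-- The intersection of two subalgebras. -/
instance TruthSubalgebra.instMin (L : Type u) [HeytingAlgebra L] [Fintype L] :
    Min (TruthSubalgebra L) where
  min M N :=
    { carrier := M.carrier ∩ N.carrier
      inf_mem := fun h h' => ⟨M.inf_mem h.1 h'.1, N.inf_mem h.2 h'.2⟩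
      sup_mem := fun h h' => ⟨M.sup_mem h.1 h'.1, N.sup_mem h.2 h'.2⟩
      himp_mem := fun h h' => ⟨M.himp_mem h.1 h'.1, N.himp_mem h.2 h'.2⟩
      T_mem := fun l _ h => ⟨M.T_mem l h.1, N.T_mem l h.2⟩
      bot_mem := ⟨M.bot_mem, N.bot_mem⟩
      top_mem := ⟨M.top_mem, N.top_mem⟩ }

/-! ### Pairwise Boolean spaces -/

/-- Pairwise Hausdorff bitopological spaces. -/
def PairwiseHausdorff {X : Type u} (τ₁ τ₂ : TopologicalSpace X) : Prop :=
  ∀ x y : X, x ≠ y → ∃ U V : Set X, IsOpen[τ₁] U ∧ IsOpen[τ₂] V ∧ x ∈ U ∧ y ∈ V ∧ Disjoint U V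

/-- Pairwise zero-dimensional bitopological spaces. -/
def PairwiseZeroDimensional {X : Type u} (τ₁ τ₂ : TopologicalSpace X) : Prop :=
  @IsTopologicalBasis X τ₁ {U | IsOpen[τ₁] U ∧ IsClosed[τ₂] U} ∧
    @IsTopologicalBasis X τ₂ {U | IsOpen[τ₂] U ∧ IsClosed[τ₁] U}

/-- Pairwise compact bitopological spaces. -/
def PairwiseCompact {X : Type u} (τ₁ τ₂ : TopologicalSpace X) : Prop :=
  ∀ 𝒰 : Set (Set X), (∀ U ∈ 𝒰, IsOpen[τ₁] U ∨ IsOpen[τ₂] U) → ⋃₀ 𝒰 = Set.univ →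
    ∃ 𝒱 ⊆ 𝒰, 𝒱.Finite ∧ ⋃₀ 𝒱 = Set.univ

/-- Pairwise Boolean spaces. -/
structure PairwiseBoolean {X : Type u} (τ₁ τ₂ : TopologicalSpace X) : Prop where
  zeroDimensional : PairwiseZeroDimensional τ₁ τ₂
  hausdorff : PairwiseHausdorff τ₁ τ₂
  compact : PairwiseCompact τ₁ τ₂

/-- The objects of `PBS_L`: a pairwise Boolean space with a map `α` from the subalgebras of `L` to
the pairwise closed subspaces, sending `L` to the whole space and meets to intersections. -/
structure PBS (L : Type u) [HeytingAlgebra L] [Fintype L] where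
  /-- the underlying set -/
  carrier : Type u
  /-- the first topology -/
  τ₁ : TopologicalSpace carrier
  /-- the second topology -/
  τ₂ : TopologicalSpace carrier
  pairwiseBoolean : PairwiseBoolean τ₁ τ₂
  /-- the assignment of a pairwise closed subspace to every subalgebra -/
  α : TruthSubalgebra L → Set carrier
  isClosed₁ : ∀ M, IsClosed[τ₁] (α M)
  isClosed₂ : ∀ M, IsClosed[τ₂] (α M)
  α_top : α ⊤ = Set.univ
  α_inf : ∀ M N, α (M ⊓ N) = α M ∩ α N

/-- The morphisms of `PBS_L`: pairwise continuous maps compatible with the maps `α`. -/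
@[ext]
structure PBSHom {L : Type u} [HeytingAlgebra L] [Fintype L] (X Y : PBS L) where
  /-- the underlying map -/
  toFun : X.carrier → Y.carrier
  continuous₁ : Continuous[X.τ₁, Y.τ₁] toFun
  continuous₂ : Continuous[X.τ₂, Y.τ₂] toFun
  map_α : ∀ (M : TruthSubalgebra L) (x : X.carrier), x ∈ X.α M → toFun x ∈ Y.α M

/-- The category `PBS_L`. -/
instance PBS.category (L : Type u) [HeytingAlgebra L] [Fintype L] : Category (PBS L) where
  Hom X Y := PBSHom X Y
  id X :=
    { toFun := fun x => x
      continuous₁ := @continuous_id _ X.τ₁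
      continuous₂ := @continuous_id _ X.τ₂
      map_α := fun _ _ h => h }
  comp {X Y Z} f g :=
    { toFun := fun x => g.toFun (f.toFun x)
      continuous₁ := @Continuous.comp _ _ _ X.τ₁ Y.τ₁ Z.τ₁ _ _ g.continuous₁ f.continuous₁
      continuous₂ := @Continuous.comp _ _ _ X.τ₂ Y.τ₂ Z.τ₂ _ _ g.continuous₂ f.continuous₂
      map_α := fun M x h => g.map_α M _ (f.map_α M x h) }

/-- A compact space whose points are separated by clopen sets is pairwise Boolean when its topology is
taken twice. -/
theorem pairwiseBoolean_same {X : Type u} (τ : TopologicalSpace X) (hc : CompactSpace X)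
    (hs : ∀ x y : X, x ≠ y → ∃ U : Set X, IsClopen U ∧ x ∈ U ∧ y ∉ U) :
    PairwiseBoolean τ τ := by
  have ht : T2Space X := ⟨fun x y h => by
    obtain ⟨U, hU, hx, hy⟩ := hs x y h
    exact ⟨U, Uᶜ, hU.isOpen, hU.compl.isOpen, hx, hy, disjoint_compl_right⟩⟩
  have hd : TotallySeparatedSpace X := by
    refine totallySeparatedSpace_iff_exists_isClopen.2 fun x y h => ?_
    obtain ⟨U, hU, hx, hy⟩ := hs x y h
    exact ⟨U, hU, hx, hy⟩
  have hb : IsTopologicalBasis {U : Set X | IsOpen U ∧ IsClosed U} := by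
    have h := isTopologicalBasis_isClopen (X := X)
    convert h using 3
    exact and_comm
  refine ⟨⟨hb, hb⟩, fun x y h => ?_, fun 𝒰 h𝒰 hcov => ?_⟩
  · obtain ⟨U, hU, hx, hy⟩ := hs x y h
    exact ⟨U, Uᶜ, hU.isOpen, hU.compl.isOpen, hx, hy, disjoint_compl_right⟩
  · obtain ⟨t, ht⟩ := isCompact_univ.elim_finite_subcover (fun U : 𝒰 => U.1)
      (fun U => (h𝒰 U.1 U.2).elim id id) (by rw [← Set.sUnion_eq_iUnion, hcov])
    refine ⟨Subtype.val '' (t : Set 𝒰), ?_, t.finite_toSet.image _, ?_⟩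
    · rintro _ ⟨U, _, rfl⟩
      exact U.2
    · refine Set.eq_univ_of_forall fun x => ?_
      obtain ⟨U, hU, hx⟩ := Set.mem_iUnion₂.1 (ht (Set.mem_univ x))
      exact ⟨U.1, ⟨U, hU, rfl⟩, hx⟩

/-- The object of `PBS_L` given by `L` with the discrete topology taken twice and `α(M) = M`. -/
def truthPBS (L : Type u) [HeytingAlgebra L] [Fintype L] : PBS L where
  carrier := L
  τ₁ := ⊥
  τ₂ := ⊥
  pairwiseBoolean := by
    let : TopologicalSpace L := ⊥
    have : DiscreteTopology L := ⟨rfl⟩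
    exact pairwiseBoolean_same ⊥ inferInstance
      fun x y h => ⟨{x}, isClopen_discrete _, rfl, fun h' => h h'.symm⟩
  α M := M.carrier
  isClosed₁ M := by
    let : TopologicalSpace L := ⊥
    have : DiscreteTopology L := ⟨rfl⟩
    exact isClosed_discrete _
  isClosed₂ M := by
    let : TopologicalSpace L := ⊥
    have : DiscreteTopology L := ⟨rfl⟩
    exact isClosed_discrete _
  α_top := rfl
  α_inf _ _ := rfl

/-! ### The functor from `PBS_L` to `L`-`VL`-algebras -/

theorem continuous_bot_op {X : Type u} {L : Type u} (τ : TopologicalSpace X) {f g : X → L}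
    (hf : Continuous[τ, ⊥] f) (hg : Continuous[τ, ⊥] g) (op : L → L → L) :
    Continuous[τ, ⊥] fun x => op (f x) (g x) := by
  let : TopologicalSpace L := ⊥
  have : DiscreteTopology L := ⟨rfl⟩
  exact (continuous_of_discreteTopology (f := fun p : L × L => op p.1 p.2)).comp (hf.prodMk hg)

section HomAlgebra

variable {L : Type u} [HeytingAlgebra L] [Fintype L] {X : PBS L}

/-- A constant map into `L` whose value lies in every subalgebra. -/
def PBSHom.const (X : PBS L) (l : L) (hl : ∀ M : TruthSubalgebra L, l ∈ M.carrier) :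
    PBSHom X (truthPBS L) where
  toFun _ := l
  continuous₁ := @continuous_const _ _ X.τ₁ ⊥ _
  continuous₂ := @continuous_const _ _ X.τ₂ ⊥ _
  map_α M _ _ := hl M

/-- The pointwise application of a binary operation on `L` under which subalgebras are closed. -/
def PBSHom.op₂ (op : L → L → L)
    (hop : ∀ (M : TruthSubalgebra L) (x y : L), x ∈ M.carrier → y ∈ M.carrier →
      op x y ∈ M.carrier)
    (φ η : PBSHom X (truthPBS L)) : PBSHom X (truthPBS L) where
  toFun x := op (φ.toFun x) (η.toFun x)
  continuous₁ := continuous_bot_op X.τ₁ φ.continuous₁ η.continuous₁ op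
  continuous₂ := continuous_bot_op X.τ₂ φ.continuous₂ η.continuous₂ op
  map_α M x h := hop M _ _ (φ.map_α M x h) (η.map_α M x h)

/-- The underlying map of a morphism into `L`, as a map into the lattice `L`. -/
def PBSHom.val (φ : PBSHom X (truthPBS L)) : X.carrier → L := φ.toFun

theorem PBSHom.val_injective :
    Function.Injective (PBSHom.val : PBSHom X (truthPBS L) → X.carrier → L) :=
  fun _ _ h => PBSHom.ext h

instance : Max (PBSHom X (truthPBS L)) :=
  ⟨PBSHom.op₂ (fun x y => x ⊔ y) fun M _ _ => M.sup_mem⟩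

instance : Min (PBSHom X (truthPBS L)) :=
  ⟨PBSHom.op₂ (fun x y => x ⊓ y) fun M _ _ => M.inf_mem⟩

instance : HImp (PBSHom X (truthPBS L)) :=
  ⟨PBSHom.op₂ (fun x y => x ⇨ y) fun M _ _ => M.himp_mem⟩

instance : Top (PBSHom X (truthPBS L)) := ⟨PBSHom.const X ⊤ fun M => M.top_mem⟩

instance : Bot (PBSHom X (truthPBS L)) := ⟨PBSHom.const X ⊥ fun M => M.bot_mem⟩

instance : Compl (PBSHom X (truthPBS L)) := ⟨fun φ => φ ⇨ ⊥⟩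

instance : LE (PBSHom X (truthPBS L)) := ⟨fun φ η => φ.val ≤ η.val⟩

instance : LT (PBSHom X (truthPBS L)) := ⟨fun φ η => φ.val < η.val⟩

/-- The pointwise Heyting algebra structure on the morphisms into `L`. -/
instance : HeytingAlgebra (PBSHom X (truthPBS L)) :=
  PBSHom.val_injective.heytingAlgebra _ Iff.rfl Iff.rfl (fun _ _ => rfl) (fun _ _ => rfl) rfl rfl
    (fun φ => funext fun x => himp_bot (φ.val x)) (fun _ _ => rfl)

theorem PBSHom.val_sup {ι : Type u} (s : Finset ι) (f : ι → PBSHom X (truthPBS L))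
    (x : X.carrier) : (s.sup f).val x = s.sup fun i => (f i).val x :=
  Finset.apply_sup_eq_sup_comp (fun φ : PBSHom X (truthPBS L) => φ.val x) (fun _ _ => rfl) rfl

theorem PBSHom.val_inf {ι : Type u} (s : Finset ι) (f : ι → PBSHom X (truthPBS L))
    (x : X.carrier) : (s.inf f).val x = s.inf fun i => (f i).val x :=
  Finset.apply_inf_eq_inf_comp (fun φ : PBSHom X (truthPBS L) => φ.val x) (fun _ _ => rfl) rfl

theorem PBSHom.ext_val {φ η : PBSHom X (truthPBS L)} (h : ∀ x, φ.val x = η.val x) : φ = η :=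
  PBSHom.val_injective (funext h)

/-- The pointwise `L`-`VL`-algebra structure on the morphisms into `L`. -/
noncomputable instance : VLAlgebra L (PBSHom X (truthPBS L)) where
  T l φ := PBSHom.op₂ (fun x _ => VLAlgebra.T l x) (fun M _ _ h _ => M.T_mem l h) φ φ
  T_himp_inf_sup l₁ l₂ a b x := VLAlgebra.T_himp_inf_sup l₁ l₂ (a.val x) (b.val x)
  T_le_T_truthT l₁ l₂ a x := VLAlgebra.T_le_T_truthT l₁ l₂ (a.val x)
  T_bot_bot := PBSHom.ext_val fun _ => VLAlgebra.T_bot_bot (L := L)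
  T_of_ne_bot l h := PBSHom.ext_val fun _ => VLAlgebra.T_of_ne_bot l h
  T_top_top := PBSHom.ext_val fun _ => VLAlgebra.T_top_top (L := L)
  T_of_ne_top l h := PBSHom.ext_val fun _ => VLAlgebra.T_of_ne_top l h
  sup_T a := PBSHom.ext_val fun x => by
    rw [PBSHom.val_sup]
    exact VLAlgebra.sup_T (L := L) (a.val x)
  T_sup_himp_bot l a := PBSHom.ext_val fun x => VLAlgebra.T_sup_himp_bot l (a.val x)
  T_inf_T l₁ l₂ a h := PBSHom.ext_val fun x => VLAlgebra.T_inf_T l₁ l₂ (a.val x) h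
  T_top_T l a := PBSHom.ext_val fun x => VLAlgebra.T_top_T l (a.val x)
  T_bot_T l a := PBSHom.ext_val fun x => VLAlgebra.T_bot_T l (a.val x)
  T_T l₁ l₂ a h h' := PBSHom.ext_val fun x => VLAlgebra.T_T l₁ l₂ (a.val x) h h'
  T_top_le a x := VLAlgebra.T_top_le (L := L) (a.val x)
  T_top_inf a b := PBSHom.ext_val fun x => VLAlgebra.T_top_inf (L := L) (a.val x) (b.val x)
  inf_T_iff_le a b x := by
    rw [PBSHom.val_inf]
    exact VLAlgebra.inf_T_iff_le (L := L) (a.val x) (b.val x)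

end HomAlgebra

/-- The contravariant functor `F = Hom(-, L)` from `PBS_L` to `L`-`VL`-algebras. -/
noncomputable def homPBSFunctor (L : Type u) [HeytingAlgebra L] [Fintype L] :
    (PBS L)ᵒᵖ ⥤ VLAlg L where
  obj X := { carrier := PBSHom X.unop (truthPBS L) }
  map f :=
    { toFun := fun η => (show PBSHom _ (truthPBS L) from f.unop ≫ (show _ ⟶ truthPBS L from η))
      map_inf := fun _ _ => rfl
      map_sup := fun _ _ => rfl
      map_himp := fun _ _ => rfl
      map_T := fun _ _ => rfl
      map_bot := rfl
      map_top := rfl }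
  map_id _ := rfl
  map_comp _ _ := rfl

/-! ### The functor from `L`-`VL`-algebras to `PBS_L` -/

section HomSpace

variable (L : Type u) [HeytingAlgebra L] [Fintype L] (A : Type u) [HeytingAlgebra A]
  [VLAlgebra L A]

/-- The set `⟨a⟩` of the homomorphisms into `L` that send `a` to `1`. -/
def basicSet (a : A) : Set (VLHom L A L) := {v | v.toFun a = ⊤}

/-- The topology `σ₁` on `Hom(A, L)`, generated by the sets `⟨a⟩`. -/
abbrev sigma₁ : TopologicalSpace (VLHom L A L) :=
  generateFrom {U | ∃ a : A, U = basicSet L A a}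

/-- The topology `σ₂` on `Hom(A, L)`, generated by the complements of the sets `⟨a⟩`. -/
abbrev sigma₂ : TopologicalSpace (VLHom L A L) :=
  generateFrom {U | ∃ a : A, U = (basicSet L A a)ᶜ}

variable {L A} [Nontrivial L]

theorem basicSet_T (l : L) (a : A) : basicSet L A (VLAlgebra.T l a) = {v | v.toFun a = l} := by
  ext v
  change v.toFun (VLAlgebra.T l a) = ⊤ ↔ v.toFun a = l
  rw [v.map_T]
  change truthT l (v.toFun a) = ⊤ ↔ _
  unfold truthT
  by_cases h : v.toFun a = l
  · simp [h]
  · simp [h]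

theorem basicSet_compl (a : A) :
    (basicSet L A a)ᶜ = basicSet L A (VLAlgebra.T (⊤ : L) a ⇨ ⊥) := by
  ext v
  change ¬ (v.toFun a = ⊤) ↔ v.toFun (VLAlgebra.T (⊤ : L) a ⇨ ⊥) = ⊤
  rw [v.map_himp, v.map_T, v.map_bot]
  change _ ↔ (truthT ⊤ (v.toFun a) ⇨ ⊥) = ⊤
  unfold truthT
  by_cases h : v.toFun a = ⊤
  · simp [h]
  · simp [h]

theorem basicSet_eq_compl (a : A) :
    basicSet L A a = (basicSet L A (VLAlgebra.T (⊤ : L) a ⇨ ⊥))ᶜ := by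
  rw [← basicSet_compl, compl_compl]

theorem sigma₂_eq : sigma₂ L A = sigma₁ L A := by
  unfold sigma₁ sigma₂
  congr 1
  ext U
  constructor
  · rintro ⟨a, rfl⟩
    exact ⟨_, basicSet_compl a⟩
  · rintro ⟨a, rfl⟩
    exact ⟨_, basicSet_eq_compl a⟩

theorem isClopen_eval (a : A) (l : L) :
    @IsClopen _ (sigma₁ L A) {v | v.toFun a = l} := by
  let := sigma₁ L A
  rw [← basicSet_T]
  refine ⟨⟨?_⟩, isOpen_generateFrom_of_mem ⟨_, rfl⟩⟩
  rw [basicSet_compl]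
  exact isOpen_generateFrom_of_mem ⟨_, rfl⟩

theorem compactSpace_hom : @CompactSpace _ (sigma₁ L A) := by
  let : TopologicalSpace L := ⊥
  have : DiscreteTopology L := ⟨rfl⟩
  let := sigma₁ L A
  have hc : IsClosed (Set.range fun (v : VLHom L A L) (a : A) => v.toFun a) := by
    have he : (Set.range fun (v : VLHom L A L) (a : A) => v.toFun a) =
        {f | ∀ a b, f (a ⊓ b) = f a ⊓ f b} ∩ {f | ∀ a b, f (a ⊔ b) = f a ⊔ f b} ∩
        {f | ∀ a b, f (a ⇨ b) = (f a ⇨ f b)} ∩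
        {f | ∀ (l : L) a, f (VLAlgebra.T l a) = VLAlgebra.T l (f a)} ∩
        {f | f ⊥ = ⊥} ∩ {f | f ⊤ = ⊤} := by
      ext f
      constructor
      · rintro ⟨v, rfl⟩
        exact ⟨⟨⟨⟨⟨v.map_inf, v.map_sup⟩, v.map_himp⟩, v.map_T⟩, v.map_bot⟩, v.map_top⟩
      · rintro ⟨⟨⟨⟨⟨h₁, h₂⟩, h₃⟩, h₄⟩, h₅⟩, h₆⟩
        exact ⟨⟨f, h₁, h₂, h₃, h₄, h₅, h₆⟩, rfl⟩
    have h₂ : ∀ (op : L → L → L) (a b c : A),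
        IsClosed {f : A → L | f a = op (f b) (f c)} := fun op a b c => by
      have h : Continuous fun f : A → L => op (f b) (f c) :=
        continuous_bot_op _ (continuous_apply b) (continuous_apply c) op
      exact isClosed_eq (continuous_apply a) h
    rw [he]
    simp only [Set.ofPred_forall]
    refine ((((IsClosed.inter ?_ ?_).inter ?_).inter ?_).inter ?_).inter ?_
    · exact isClosed_iInter fun a => isClosed_iInter fun b => h₂ (· ⊓ ·) _ _ _
    · exact isClosed_iInter fun a => isClosed_iInter fun b => h₂ (· ⊔ ·) _ _ _
    · exact isClosed_iInter fun a => isClosed_iInter fun b => h₂ (· ⇨ ·) _ _ _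
    · exact isClosed_iInter fun l => isClosed_iInter fun a =>
        h₂ (fun x _ => VLAlgebra.T l x) _ a a
    · exact h₂ (fun _ _ => ⊥) _ ⊥ ⊥
    · exact h₂ (fun _ _ => ⊤) _ ⊥ ⊥
  have hi : Topology.IsInducing fun (v : VLHom L A L) (a : A) => v.toFun a := by
    refine ⟨le_antisymm ?_ ?_⟩
    · refine continuous_iff_le_induced.1 (continuous_pi fun a => ?_)
      exact continuous_discrete_rng.2 fun l => (isClopen_eval a l).isOpen
    · refine le_generateFrom ?_
      rintro _ ⟨a, rfl⟩
      have ho : IsOpen ((fun f : A → L => f a) ⁻¹' {⊤}) :=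
        (isOpen_discrete {(⊤ : L)}).preimage (continuous_apply a)
      exact ⟨_, ho, rfl⟩
  refine ⟨hi.isCompact_iff.2 ?_⟩
  rw [Set.image_univ]
  exact hc.isCompact

theorem pairwiseBoolean_hom : PairwiseBoolean (sigma₁ L A) (sigma₂ L A) := by
  rw [sigma₂_eq]
  let := sigma₁ L A
  refine pairwiseBoolean_same _ compactSpace_hom fun v w h => ?_
  have ha : ∃ a, v.toFun a ≠ w.toFun a := by
    by_contra! h'
    exact h (VLHom.ext (funext h'))
  obtain ⟨a, ha⟩ := ha
  exact ⟨_, isClopen_eval a (v.toFun a), rfl, fun h' => ha h'.symm⟩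

theorem isClosed_homSub (M : TruthSubalgebra L) :
    IsClosed[sigma₁ L A] {v : VLHom L A L | ∀ a, v.toFun a ∈ M.carrier} := by
  let := sigma₁ L A
  simp only [Set.ofPred_forall]
  refine isClosed_iInter fun a => ?_
  have he : {v : VLHom L A L | v.toFun a ∈ M.carrier} =
      ⋃ l ∈ M.carrier, {v : VLHom L A L | v.toFun a = l} := by
    ext v
    simp
  rw [he]
  exact M.carrier.toFinite.isClosed_biUnion fun l _ => (isClopen_eval a l).isClosed

variable (L A)

/-- The object `Hom(A, L)` of `PBS_L`, with `α(M) = Hom(A, M)`, the set of the homomorphisms into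
`L` all of whose values lie in `M`. -/
def homSpace : PBS L where
  carrier := VLHom L A L
  τ₁ := sigma₁ L A
  τ₂ := sigma₂ L A
  pairwiseBoolean := pairwiseBoolean_hom
  α M := {v | ∀ a, v.toFun a ∈ M.carrier}
  isClosed₁ := isClosed_homSub
  isClosed₂ M := by
    rw [sigma₂_eq]
    exact isClosed_homSub M
  α_top := Set.eq_univ_of_forall fun _ _ => Set.mem_univ _
  α_inf _ _ := Set.ext fun _ => forall_and

end HomSpace

/-- The contravariant functor `G = Hom(-, L)` from `L`-`VL`-algebras to `PBS_L`. -/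
noncomputable def homVLFunctor (L : Type u) [HeytingAlgebra L] [Fintype L] [Nontrivial L] :
    VLAlg L ⥤ (PBS L)ᵒᵖ where
  obj A := Opposite.op (homSpace L A.carrier)
  map {A B} g := Quiver.Hom.op
    { toFun := fun μ : VLHom L B.carrier L =>
        { toFun := fun a => μ.toFun (g.toFun a)
          map_inf := fun a b => by rw [g.map_inf, μ.map_inf]
          map_sup := fun a b => by rw [g.map_sup, μ.map_sup]
          map_himp := fun a b => by rw [g.map_himp, μ.map_himp]
          map_T := fun l a => by rw [g.map_T, μ.map_T]
          map_bot := by rw [g.map_bot, μ.map_bot]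
          map_top := by rw [g.map_top, μ.map_top] }
      continuous₁ := by
        refine continuous_generateFrom_iff.2 ?_
        rintro _ ⟨a, rfl⟩
        exact isOpen_generateFrom_of_mem ⟨g.toFun a, rfl⟩
      continuous₂ := by
        refine continuous_generateFrom_iff.2 ?_
        rintro _ ⟨a, rfl⟩
        exact isOpen_generateFrom_of_mem ⟨g.toFun a, rfl⟩
      map_α := fun _ _ h a => h (g.toFun a) }
  map_id _ := rfl
  map_comp _ _ := rfl

/-! A prime ideal `J` of an algebra `A` gives a homomorphism `A → L`: by condition (3) exactly one
of the elements `T_l(a)` lies outside `J`, and by condition (1) sending `a` to this `l` preserves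
the operations. Hence, by the prime ideal theorem and condition (6), the homomorphisms into `L`
separate the elements of `A`. A morphism `Hom(A, L) → L` takes its value at `v` in the range of
`v`, so that near `v` it is the evaluation at some element of `A`; compactness makes finitely many
of these elements suffice, and they are glued by joins of elements `T_1(c) ∧ a`. So the evaluation
`A → F(G(A))` is bijective.

The two topologies of a pairwise Boolean space coincide, hence such a space is a Stone space. A
point `x` has a support, the least subalgebra `M` with `x ∈ α(M)`, and by local constancy the
support consists of the values at `x` of the morphisms `X → L`; this recovers `α` from these
morphisms. The evaluation `X → G(F(X))` is injective, since clopen sets separate points, and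
surjective, since its range is dense and compact. -/

section PrimeIdeal

theorem existsUnique_notMem_of_isPrime {P ι : Type*} [Lattice P] [BoundedOrder P] [Fintype ι]
    {J : Order.Ideal P} (hJ : J.IsPrime) {f : ι → P} (hsup : Finset.univ.sup f = ⊤)
    (hinf : ∀ i j, i ≠ j → f i ⊓ f j = ⊥) : ∃! i, f i ∉ J := by
  obtain ⟨i, hi⟩ : ∃ i, f i ∉ J := by
    by_contra! h
    exact hJ.toIsProper.top_notMem <| hsup ▸ (Order.Ideal.finsetSup_mem_iff J).2 fun i _ => h i
  refine ⟨i, hi, fun j hj => ?_⟩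
  by_contra hne
  have hmem : f j ⊓ f i ∈ J := hinf j i hne ▸ J.bot_mem
  exact (hJ.mem_or_mem hmem).elim hj hi

variable (L : Type u) [HeytingAlgebra L] [Fintype L] {A : Type u} [HeytingAlgebra A]
  [VLAlgebra L A] (J : Order.Ideal A) [hJ : J.IsPrime]

theorem existsUnique_T_notMem (a : A) : ∃! l : L, VLAlgebra.T l a ∉ J :=
  existsUnique_notMem_of_isPrime hJ (VLAlgebra.sup_T a) fun l k => VLAlgebra.T_inf_T l k a

/-- The truth value of an element modulo a prime ideal `J`: the unique `l` with `T_l(a) ∉ J`. -/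
noncomputable def truthValue (a : A) : L := (existsUnique_T_notMem L J a).choose

variable {L}

theorem truthValue_eq_iff {a : A} {l : L} : truthValue L J a = l ↔ VLAlgebra.T l a ∉ J := by
  obtain ⟨hmem, huniq⟩ := (existsUnique_T_notMem L J a).choose_spec
  exact ⟨fun h => h ▸ hmem, fun h => (huniq l h).symm⟩

theorem T_truthValue_notMem (a : A) : VLAlgebra.T (truthValue L J a) a ∉ J :=
  (truthValue_eq_iff J).1 rfl

theorem truthValue_eq_of_T_inf_T_le {a b c : A} {l : L}
    (h : VLAlgebra.T (truthValue L J a) a ⊓ VLAlgebra.T (truthValue L J b) b ≤ VLAlgebra.T l c) :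
    truthValue L J c = l :=
  (truthValue_eq_iff J).2 fun hc => (hJ.mem_or_mem (J.lower h hc)).elim
    (T_truthValue_notMem J a) (T_truthValue_notMem J b)

variable (L)

/-- The homomorphism into the lattice of truth values given by a prime ideal. -/
noncomputable def VLHom.ofPrimeIdeal : VLHom L A L where
  toFun := truthValue L J
  map_inf a b := truthValue_eq_of_T_inf_T_le J <|
    (VLAlgebra.T_himp_inf_sup _ _ a b).trans (inf_le_left.trans inf_le_right)
  map_sup a b := truthValue_eq_of_T_inf_T_le J <|
    (VLAlgebra.T_himp_inf_sup _ _ a b).trans inf_le_right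
  map_himp a b := truthValue_eq_of_T_inf_T_le J <|
    (VLAlgebra.T_himp_inf_sup _ _ a b).trans (inf_le_left.trans inf_le_left)
  map_T l a := truthValue_eq_of_T_inf_T_le J (b := a) <|
    inf_le_left.trans (VLAlgebra.T_le_T_truthT l _ a)
  map_bot := (truthValue_eq_iff J).2 <|
    (VLAlgebra.T_bot_bot (L := L) (A := A)).symm ▸ hJ.toIsProper.top_notMem
  map_top := (truthValue_eq_iff J).2 <|
    (VLAlgebra.T_top_top (L := L) (A := A)).symm ▸ hJ.toIsProper.top_notMem

end PrimeIdeal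

namespace VLHom

variable {L : Type u} [HeytingAlgebra L] [Fintype L] {A B : Type u} [HeytingAlgebra A]
  [VLAlgebra L A] [HeytingAlgebra B] [VLAlgebra L B]

theorem T_le_T_of_forall_eq {a b : A} (h : ∀ v : VLHom L A L, v.toFun a = v.toFun b) (l : L) :
    VLAlgebra.T l a ≤ VLAlgebra.T l b := by
  by_contra hle
  have hdisj : Disjoint (Order.PFilter.principal (VLAlgebra.T l a) : Set A)
      (Order.Ideal.principal (VLAlgebra.T l b)) :=
    Set.disjoint_left.2 fun x hx hx' => hle (le_trans hx hx')
  obtain ⟨J, hJ, hbJ, haJ⟩ := DistribLattice.prime_ideal_of_disjoint_filter_ideal hdisj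
  have ha : truthValue L J a = l :=
    (truthValue_eq_iff J).2 fun hmem => Set.disjoint_left.1 haJ le_rfl hmem
  have hb : truthValue L J b = l := (h (ofPrimeIdeal L J)).symm.trans ha
  exact (truthValue_eq_iff J).1 hb (hbJ le_rfl)

theorem eq_of_forall_eq {a b : A} (h : ∀ v : VLHom L A L, v.toFun a = v.toFun b) : a = b := by
  have hT (l : L) : VLAlgebra.T l a = VLAlgebra.T l b :=
    le_antisymm (T_le_T_of_forall_eq h l) (T_le_T_of_forall_eq (fun v => (h v).symm) l)
  have hle := VLAlgebra.inf_T_iff_le (L := L) a b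
  simp only [hT, himp_self, inf_top_eq, Finset.inf_top, top_le_iff, inf_eq_top_iff,
    himp_eq_top_iff] at hle
  exact le_antisymm hle.1 hle.2

/-- The subalgebra of the truth values taken by a homomorphism. -/
def range (v : VLHom L A L) : TruthSubalgebra L where
  carrier := Set.range v.toFun
  inf_mem := by
    rintro _ _ ⟨a, rfl⟩ ⟨b, rfl⟩
    exact ⟨a ⊓ b, v.map_inf a b⟩
  sup_mem := by
    rintro _ _ ⟨a, rfl⟩ ⟨b, rfl⟩
    exact ⟨a ⊔ b, v.map_sup a b⟩
  himp_mem := by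
    rintro _ _ ⟨a, rfl⟩ ⟨b, rfl⟩
    exact ⟨a ⇨ b, v.map_himp a b⟩
  T_mem := by
    rintro l _ ⟨a, rfl⟩
    exact ⟨VLAlgebra.T l a, v.map_T l a⟩
  bot_mem := ⟨⊥, v.map_bot⟩
  top_mem := ⟨⊤, v.map_top⟩

open Classical in
theorem map_T_top_inf (v : VLHom L A L) (c a : A) :
    v.toFun (VLAlgebra.T (⊤ : L) c ⊓ a) = if v.toFun c = ⊤ then v.toFun a else ⊥ := by
  have hT : v.toFun (VLAlgebra.T (⊤ : L) c) = if v.toFun c = ⊤ then ⊤ else ⊥ := v.map_T ⊤ c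
  rw [v.map_inf, hT]
  split_ifs
  exacts [top_inf_eq _, bot_inf_eq _]

/-- The inverse of a bijective homomorphism. -/
def inverse (f : VLHom L A B) (g : B → A) (hl : Function.LeftInverse g f.toFun)
    (hr : Function.RightInverse g f.toFun) : VLHom L B A where
  toFun := g
  map_inf a b := hl.injective.eq_iff.1 (by simp only [f.map_inf, hr _])
  map_sup a b := hl.injective.eq_iff.1 (by simp only [f.map_sup, hr _])
  map_himp a b := hl.injective.eq_iff.1 (by simp only [f.map_himp, hr _])
  map_T l a := hl.injective.eq_iff.1 (by simp only [f.map_T, hr _])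
  map_bot := hl.injective.eq_iff.1 (by simp only [f.map_bot, hr _])
  map_top := hl.injective.eq_iff.1 (by simp only [f.map_top, hr _])

end VLHom

/-- The isomorphism of `L`-`VL`-algebras given by a bijective homomorphism. -/
noncomputable def VLAlg.isoOfBijective {L : Type u} [HeytingAlgebra L] [Fintype L] {A B : VLAlg L}
    (f : VLHom L A.carrier B.carrier) (hf : Function.Bijective f.toFun) : A ≅ B :=
  let e := Equiv.ofBijective f.toFun hf
  { hom := f
    inv := f.inverse e.symm e.left_inv e.right_inv
    hom_inv_id := VLHom.ext (funext e.left_inv)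
    inv_hom_id := VLHom.ext (funext e.right_inv) }

section Bitopology

variable {X : Type u} {τ₁ τ₂ : TopologicalSpace X}

theorem PairwiseHausdorff.symm (h : PairwiseHausdorff τ₁ τ₂) : PairwiseHausdorff τ₂ τ₁ :=
  fun x y hxy =>
    let ⟨U, V, hU, hV, hy, hx, hUV⟩ := h y x hxy.symm
    ⟨V, U, hV, hU, hx, hy, hUV.symm⟩

theorem PairwiseCompact.symm (h : PairwiseCompact τ₁ τ₂) : PairwiseCompact τ₂ τ₁ :=
  fun 𝒰 h𝒰 => h 𝒰 fun U hU => (h𝒰 U hU).symm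

theorem PairwiseCompact.compactSpace (h : PairwiseCompact τ₁ τ₂) : @CompactSpace X τ₁ :=
  @compactSpace_generateFrom X τ₁ _ (generateFrom_setOfPred_isOpen τ₁).symm fun 𝒰 h𝒰 hcov =>
    h 𝒰 (fun _ hU => Or.inl (h𝒰 hU)) hcov

theorem PairwiseHausdorff.disjoint_nhds (h : PairwiseHausdorff τ₁ τ₂) {x y : X} (hxy : x ≠ y) :
    Disjoint (@nhds X τ₁ x) (@nhds X τ₂ y) := by
  obtain ⟨U, V, hU, hV, hx, hy, hUV⟩ := h x y hxy
  exact Filter.disjoint_iff.2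
    ⟨U, @IsOpen.mem_nhds X τ₁ _ _ hU hx, V, @IsOpen.mem_nhds X τ₂ _ _ hV hy, hUV⟩

-- A `τ₁`-open set contains a `τ₂`-neighbourhood of each of its points, because its complement is
-- `τ₁`-compact and so can be separated from the point.
theorem PairwiseHausdorff.le (h : PairwiseHausdorff τ₁ τ₂) (hc : @CompactSpace X τ₁) :
    τ₂ ≤ τ₁ := by
  intro U (hU : IsOpen[τ₁] U)
  refine (@isOpen_iff_mem_nhds X τ₂ U).2 fun x hx => ?_
  let := τ₁
  have hdisj : Disjoint (𝓝ˢ Uᶜ) (@nhds X τ₂ x) :=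
    hU.isClosed_compl.isCompact.disjoint_nhdsSet_left.2 fun y hy =>
      h.disjoint_nhds fun hyx => hy (hyx ▸ hx)
  simpa only [Filter.disjoint_principal_left, compl_compl] using
    hdisj.mono_left principal_le_nhdsSet

theorem PairwiseBoolean.eq (h : PairwiseBoolean τ₁ τ₂) : τ₂ = τ₁ :=
  le_antisymm (h.hausdorff.le h.compact.compactSpace)
    (h.hausdorff.symm.le h.compact.symm.compactSpace)

theorem PairwiseBoolean.totallySeparatedSpace (h : PairwiseBoolean τ₁ τ₂) :
    @TotallySeparatedSpace X τ₁ := by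
  obtain rfl := h.eq
  refine totallySeparatedSpace_iff_exists_isClopen.2 fun x y hxy => ?_
  obtain ⟨V, W, hV, -, hxV, hyW, hVW⟩ := h.hausdorff x y hxy
  obtain ⟨U, ⟨hopen, hclosed⟩, hxU, hUV⟩ :=
    h.zeroDimensional.1.exists_subset_of_mem_open hxV hV
  exact ⟨U, ⟨hclosed, hopen⟩, hxU, fun hyU => Set.disjoint_left.1 hVW (hUV hyU) hyW⟩

end Bitopology

open Classical in
theorem isLocallyConstant_ite_mem {X Y : Type*} [TopologicalSpace X] {U : Set X} (hU : IsClopen U)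
    (y z : Y) : IsLocallyConstant fun x => if x ∈ U then y else z := by
  refine (IsLocallyConstant.iff_eventually_eq _).2 fun x => ?_
  by_cases hx : x ∈ U
  · filter_upwards [hU.isOpen.mem_nhds hx] with w hw
    rw [if_pos hw, if_pos hx]
  · filter_upwards [hU.compl.isOpen.mem_nhds hx] with w hw
    rw [if_neg hw, if_neg hx]

namespace TruthSubalgebra

variable {L : Type u} [HeytingAlgebra L] [Fintype L]

instance : PartialOrder (TruthSubalgebra L) :=
  PartialOrder.lift carrier fun _ _ => TruthSubalgebra.ext

instance : SemilatticeInf (TruthSubalgebra L) where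
  inf M N := M ⊓ N
  inf_le_left _ _ := Set.inter_subset_left
  inf_le_right _ _ := Set.inter_subset_right
  le_inf _ _ _ := Set.subset_inter

instance : OrderTop (TruthSubalgebra L) where
  le_top M := Set.subset_univ M.carrier

instance : Finite (TruthSubalgebra L) :=
  Finite.of_injective carrier fun _ _ => TruthSubalgebra.ext

end TruthSubalgebra

-- Only the first topologies become instances: the second ones equal them.
attribute [local instance] PBS.τ₁ sigma₁

namespace PBS

variable {L : Type u} [HeytingAlgebra L] [Fintype L] (X : PBS L)

instance : CompactSpace X.carrier := X.pairwiseBoolean.compact.compactSpace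

instance : TotallySeparatedSpace X.carrier := X.pairwiseBoolean.totallySeparatedSpace

theorem τ₂_eq : X.τ₂ = X.τ₁ := X.pairwiseBoolean.eq

end PBS

namespace PBSHom

variable {L : Type u} [HeytingAlgebra L] [Fintype L] {X Y : PBS L}

/-- A morphism of `PBS_L` from a map that is continuous for the first topologies. -/
def ofContinuous (f : X.carrier → Y.carrier) (hf : Continuous f)
    (hα : ∀ M x, x ∈ X.α M → f x ∈ Y.α M) : PBSHom X Y where
  toFun := f
  continuous₁ := hf
  continuous₂ := by rwa [X.τ₂_eq, Y.τ₂_eq]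
  map_α := hα

/-- A morphism into `L` from a locally constant map. -/
def ofIsLocallyConstant (f : X.carrier → L) (hf : IsLocallyConstant f)
    (hα : ∀ M x, x ∈ X.α M → f x ∈ M.carrier) : PBSHom X (truthPBS L) :=
  ofContinuous (Y := truthPBS L) f (@IsLocallyConstant.continuous _ _ _ ⊥ f hf) hα

theorem isLocallyConstant_val (φ : PBSHom X (truthPBS L)) : IsLocallyConstant φ.val :=
  (@IsLocallyConstant.iff_continuous _ _ _ ⊥ (discreteTopology_bot L) φ.val).2 φ.continuous₁

end PBSHom

namespace PBS

variable {L : Type u} [HeytingAlgebra L] [Fintype L] {X Y : PBS L}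

/-- The isomorphism given by a bijective morphism that reflects the subspaces `α(M)`. -/
noncomputable def isoOfBijective (f : PBSHom X Y) (hf : Function.Bijective f.toFun)
    (hα : ∀ M x, f.toFun x ∈ Y.α M → x ∈ X.α M) : X ≅ Y :=
  let e := Equiv.ofBijective f.toFun hf
  { hom := f
    inv := PBSHom.ofContinuous e.symm
      (Continuous.continuous_symm_of_equiv_compact_to_t2 (f := e) f.continuous₁)
      fun M y hy => hα M (e.symm y) (Set.mem_of_eq_of_mem (e.apply_symm_apply y) hy)
    hom_inv_id := PBSHom.ext (funext e.left_inv)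
    inv_hom_id := PBSHom.ext (funext e.right_inv) }

/-- The support of a point `x`: the least subalgebra `M` with `x ∈ α(M)`. -/
noncomputable def support (x : X.carrier) : TruthSubalgebra L :=
  (Set.toFinite {M | x ∈ X.α M}).toFinset.inf id

theorem mem_α_support (x : X.carrier) : x ∈ X.α (support x) := by
  rw [support, Finset.apply_inf_eq_inf_comp X.α X.α_inf X.α_top, Finset.inf_set_eq_iInter]
  exact Set.mem_iInter₂.2 fun M hM => by simpa using hM

theorem α_mono : Monotone X.α := fun M N h => by
  rw [← inf_eq_left.2 h, X.α_inf]
  exact Set.inter_subset_right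

theorem support_le_iff {x : X.carrier} {M : TruthSubalgebra L} : support x ≤ M ↔ x ∈ X.α M :=
  ⟨fun h => α_mono h (mem_α_support x), fun h => Finset.inf_le (f := id) (by simpa using h)⟩

theorem isOpen_setOf_le_support (M : TruthSubalgebra L) :
    IsOpen {x : X.carrier | M ≤ support x} := by
  have hcompl : {x : X.carrier | M ≤ support x}ᶜ = ⋃ K ∈ {K | ¬ M ≤ K}, X.α K := by
    ext x
    simp only [Set.mem_compl_iff, Set.mem_ofPred_eq, Set.mem_iUnion₂, exists_prop,
      ← support_le_iff]
    exact ⟨fun h => ⟨support x, h, le_rfl⟩, fun ⟨K, hK, hle⟩ h => hK (h.trans hle)⟩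
  rw [← isClosed_compl_iff, hcompl]
  exact (Set.toFinite _).isClosed_biUnion fun K _ => X.isClosed₁ K

open Classical in
/-- The morphism with value `l` on a clopen set and `0` elsewhere. -/
noncomputable def indicator {U : Set X.carrier} (hU : IsClopen U) (l : L)
    (hl : ∀ x ∈ U, l ∈ (support x).carrier) : PBSHom X (truthPBS L) :=
  PBSHom.ofIsLocallyConstant (fun x => if x ∈ U then l else ⊥) (isLocallyConstant_ite_mem hU l ⊥)
    fun M x hx => by
      split_ifs with hxU
      exacts [support_le_iff.2 hx (hl x hxU), M.bot_mem]

theorem mem_support_iff_exists_val_eq {x : X.carrier} {l : L} :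
    l ∈ (support x).carrier ↔ ∃ φ : PBSHom X (truthPBS L), φ.val x = l := by
  refine ⟨fun hl => ?_, ?_⟩
  · obtain ⟨U, hU, hxU, hle⟩ := compact_exists_isClopen_in_isOpen
      (isOpen_setOf_le_support (support x)) (le_refl (support x))
    exact ⟨indicator hU l fun y hy => hle hy hl, if_pos hxU⟩
  · rintro ⟨φ, rfl⟩
    exact φ.map_α (support x) x (mem_α_support x)

theorem mem_α_iff_forall_val_mem {x : X.carrier} {M : TruthSubalgebra L} :
    x ∈ X.α M ↔ ∀ φ : PBSHom X (truthPBS L), φ.val x ∈ M.carrier := by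
  refine ⟨fun hx φ => φ.map_α M x hx, fun h => support_le_iff.1 fun l hl => ?_⟩
  obtain ⟨φ, rfl⟩ := mem_support_iff_exists_val_eq.1 hl
  exact h φ

end PBS

section EvalElement

variable {L : Type u} [HeytingAlgebra L] [Fintype L] {A : Type u} [HeytingAlgebra A]
  [VLAlgebra L A]

theorem isTopologicalBasis_basicSet :
    IsTopologicalBasis {U : Set (VLHom L A L) | ∃ a : A, U = basicSet L A a} := by
  have hinter : ∀ᵉ (U ∈ {U | ∃ a, U = basicSet L A a}) (V ∈ {U | ∃ a, U = basicSet L A a}),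
      U ∩ V ∈ {U | ∃ a, U = basicSet L A a} := by
    rintro _ ⟨a, rfl⟩ _ ⟨b, rfl⟩
    refine ⟨a ⊓ b, Set.ext fun v => ?_⟩
    change v.toFun a = ⊤ ∧ v.toFun b = ⊤ ↔ v.toFun (a ⊓ b) = ⊤
    rw [v.map_inf, inf_eq_top_iff]
  have huniv : Set.univ ∈ {U | ∃ a, U = basicSet L A a} :=
    ⟨⊤, (Set.eq_univ_of_forall fun v => v.map_top).symm⟩
  simpa only [Set.insert_eq_of_mem huniv] using
    isTopologicalBasis_of_subbasis_of_inter (r := {U | ∃ a, U = basicSet L A a}) rfl hinter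

variable [Nontrivial L]

instance : CompactSpace (VLHom L A L) := compactSpace_hom

theorem VLHom.isLocallyConstant_apply (a : A) :
    IsLocallyConstant fun v : VLHom L A L => v.toFun a :=
  IsLocallyConstant.iff_isOpen_fiber.2 fun l => (isClopen_eval a l).isOpen

theorem VLHom.exists_forall_apply_eq {f : VLHom L A L → L}
    (hf : ∀ v, ∃ a : A, ∀ᶠ w in 𝓝 v, w.toFun a = f w) : ∃ a : A, ∀ w, w.toFun a = f w := by
  classical
  have hbasic (v : VLHom L A L) : ∃ a c : A, v.toFun c = ⊤ ∧
      ∀ w : VLHom L A L, w.toFun c = ⊤ → w.toFun a = f w := by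
    obtain ⟨a, ha⟩ := hf v
    obtain ⟨_, ⟨c, rfl⟩, hv, hc⟩ := isTopologicalBasis_basicSet.mem_nhds_iff.1 ha
    exact ⟨a, c, hv, hc⟩
  choose a c hv hac using hbasic
  obtain ⟨t, ht⟩ := CompactSpace.elim_nhds_subcover (fun v => basicSet L A (c v)) fun v =>
    (isTopologicalBasis_basicSet.isOpen ⟨c v, rfl⟩).mem_nhds (hv v)
  have hterm (w v : VLHom L A L) : w.toFun (VLAlgebra.T (⊤ : L) (c v) ⊓ a v) =
      if w.toFun (c v) = ⊤ then f w else ⊥ :=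
    (w.map_T_top_inf (c v) (a v)).trans (ite_congr rfl (hac v w) fun _ => rfl)
  refine ⟨t.sup fun v => VLAlgebra.T (⊤ : L) (c v) ⊓ a v, fun w => ?_⟩
  rw [Finset.apply_sup_eq_sup_comp w.toFun w.map_sup w.map_bot]
  obtain ⟨v, hvt, hwv⟩ := Set.mem_iUnion₂.1 (ht.symm.subset (Set.mem_univ w))
  refine le_antisymm (Finset.sup_le fun u _ => ?_) ?_
  · rw [Function.comp_apply, hterm]
    split_ifs
    exacts [le_rfl, bot_le]
  · calc f w = w.toFun (VLAlgebra.T (⊤ : L) (c v) ⊓ a v) := ((hterm w v).trans (if_pos hwv)).symm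
      _ ≤ _ := Finset.le_sup (f := w.toFun ∘ fun v => VLAlgebra.T (⊤ : L) (c v) ⊓ a v) hvt

/-- The evaluation at an element of an algebra, as a morphism of `PBS_L`. -/
def evalElement (a : A) : PBSHom (homSpace L A) (truthPBS L) :=
  PBSHom.ofIsLocallyConstant (X := homSpace L A) (fun v : VLHom L A L => v.toFun a)
    (VLHom.isLocallyConstant_apply (L := L) a) fun _ _ hv => hv a

theorem evalElement_injective :
    Function.Injective (evalElement : A → PBSHom (homSpace L A) (truthPBS L)) :=
  fun _ _ h => VLHom.eq_of_forall_eq (congrFun (congrArg PBSHom.val h))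

theorem evalElement_surjective :
    Function.Surjective (evalElement : A → PBSHom (homSpace L A) (truthPBS L)) := by
  intro φ
  have hφ : IsLocallyConstant fun v : VLHom L A L => φ.val v := φ.isLocallyConstant_val
  have hlocal (v : VLHom L A L) : ∃ a : A, ∀ᶠ w in 𝓝 v, w.toFun a = φ.val w := by
    obtain ⟨a, ha⟩ : φ.val v ∈ v.range.carrier := φ.map_α v.range v fun a => ⟨a, rfl⟩
    refine ⟨a, ?_⟩
    filter_upwards [(VLHom.isLocallyConstant_apply a).eventually_eq v, hφ.eventually_eq v]
      with w hwa hwφ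
    rw [hwa, ha, hwφ]
  obtain ⟨a, ha⟩ := VLHom.exists_forall_apply_eq hlocal
  exact ⟨a, PBSHom.ext_val ha⟩

variable (L A) in
/-- The unit of the duality at an algebra: the evaluation at its elements, as a homomorphism. -/
def evalElementHom : VLHom L A (PBSHom (homSpace L A) (truthPBS L)) where
  toFun := evalElement
  map_inf a b := PBSHom.ext_val fun v => VLHom.map_inf v a b
  map_sup a b := PBSHom.ext_val fun v => VLHom.map_sup v a b
  map_himp a b := PBSHom.ext_val fun v => VLHom.map_himp v a b
  map_T l a := PBSHom.ext_val fun v => VLHom.map_T v l a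
  map_bot := PBSHom.ext_val fun v => VLHom.map_bot v
  map_top := PBSHom.ext_val fun v => VLHom.map_top v

end EvalElement

section EvalPoint

variable {L : Type u} [HeytingAlgebra L] [Fintype L] {X : PBS L}

/-- The evaluation at a point of a space, as a homomorphism. -/
def evalPoint (x : X.carrier) : VLHom L (PBSHom X (truthPBS L)) L where
  toFun φ := φ.val x
  map_inf _ _ := rfl
  map_sup _ _ := rfl
  map_himp _ _ := rfl
  map_T _ _ := rfl
  map_bot := rfl
  map_top := rfl

theorem continuous_evalPoint :
    Continuous (evalPoint : X.carrier → VLHom L (PBSHom X (truthPBS L)) L) := by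
  refine continuous_generateFrom_iff.2 ?_
  rintro _ ⟨φ, rfl⟩
  exact φ.isLocallyConstant_val.isOpen_fiber ⊤

variable [Nontrivial L]

theorem evalPoint_injective :
    Function.Injective (evalPoint : X.carrier → VLHom L (PBSHom X (truthPBS L)) L) := by
  classical
  intro x y h
  by_contra hne
  obtain ⟨U, hU, hx, hy⟩ := totallySeparatedSpace_iff_exists_isClopen.1 inferInstance hne
  have hval : (if x ∈ U then ⊤ else ⊥ : L) = if y ∈ U then ⊤ else ⊥ :=
    congrArg (fun v => v.toFun (PBS.indicator hU ⊤ fun z _ => (PBS.support z).top_mem)) h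
  rw [if_pos hx, if_neg hy] at hval
  exact top_ne_bot hval

theorem denseRange_evalPoint :
    DenseRange (evalPoint : X.carrier → VLHom L (PBSHom X (truthPBS L)) L) := by
  refine isTopologicalBasis_basicSet.dense_iff.2 ?_
  rintro _ ⟨φ, rfl⟩ ⟨v, hv : v.toFun φ = ⊤⟩
  suffices ∃ x, φ.val x = ⊤ by
    obtain ⟨x, hx⟩ := this
    exact ⟨evalPoint x, hx, x, rfl⟩
  by_contra! h
  have hT : VLAlgebra.T (⊤ : L) φ = ⊥ := PBSHom.ext_val fun x => if_neg (h x)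
  have htop : v.toFun (VLAlgebra.T (⊤ : L) φ) = ⊤ := (v.map_T ⊤ φ).trans (if_pos hv)
  rw [hT, v.map_bot] at htop
  exact bot_ne_top htop

theorem evalPoint_surjective :
    Function.Surjective (evalPoint : X.carrier → VLHom L (PBSHom X (truthPBS L)) L) := by
  have : T2Space (VLHom L (PBSHom X (truthPBS L)) L) :=
    inferInstanceAs (T2Space (homSpace L _).carrier)
  rw [← Set.range_eq_univ, ← (isCompact_range continuous_evalPoint).isClosed.closure_eq]
  exact denseRange_evalPoint.closure_range

variable (X) in
/-- The counit of the duality at a space: the evaluation at its points, as an isomorphism. -/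
noncomputable def evalPointIso : X ≅ homSpace L (PBSHom X (truthPBS L)) :=
  PBS.isoOfBijective
    (PBSHom.ofContinuous (Y := homSpace L _) evalPoint continuous_evalPoint
      fun _ _ => PBS.mem_α_iff_forall_val_mem.1)
    ⟨evalPoint_injective, evalPoint_surjective⟩ fun _ _ => PBS.mem_α_iff_forall_val_mem.2

end EvalPoint

/-- The unit of the duality, given by the evaluations at the elements of the algebras. -/
noncomputable def evalElementNatIso (L : Type u) [HeytingAlgebra L] [Fintype L] [Nontrivial L] :
    𝟭 (VLAlg L) ≅ homVLFunctor L ⋙ homPBSFunctor L :=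
  NatIso.ofComponents
    (fun A => VLAlg.isoOfBijective (B := (homVLFunctor L ⋙ homPBSFunctor L).obj A)
      (evalElementHom L A.carrier) ⟨evalElement_injective, evalElement_surjective⟩)
    fun _ => rfl

/-- The counit of the duality, given by the evaluations at the points of the spaces. -/
noncomputable def evalPointNatIso (L : Type u) [HeytingAlgebra L] [Fintype L] [Nontrivial L] :
    homPBSFunctor L ⋙ homVLFunctor L ≅ 𝟭 (PBS L)ᵒᵖ :=
  NatIso.ofComponents (fun X => (evalPointIso X.unop).op) fun _ => rfl

theorem theorem1 (L : Type u) [HeytingAlgebra L] [Fintype L] [Nontrivial L] :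
    ∃ e : VLAlg L ≌ (PBS L)ᵒᵖ,
      e.functor = homVLFunctor L ∧ e.inverse = homPBSFunctor L :=
  ⟨CategoryTheory.Equivalence.mk _ _ (evalElementNatIso L) (evalPointNatIso L), rfl, rfl⟩
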